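/- Fix real parameters $0<\lambda_0<1/3$, $0<\lambda_1<1/3$, $\beta_0>6$, $0<\sigma<1/3$, $3<\beta_1<4$. Let $I=[0,1]$, $R=I^3$, $R_0=I\times I\times[0,1/6]$, $R_1=I\times I\times[5/6,1]$, and let $f:I\to I$ be the time-one map of the vector field $x'=x(1-x)$, so that $f(0)=0$, $f(1)=1$, $f'(0)=e$, $f'(1)=1/e$. Let $F$ be a Díaz–Horita–Rios–Sambarino partially hyperbolic horseshoe map with these parameters: a diffeomorphism of $\mathbb R^3$ (it is enough that $F:\mathbb R^3\to\mathbb R^3$ is Borel measurable and differentiable at every point of $R_0\cup R_1$) such that $$F(x,y,z)=(\lambda_0x,\,f(y),\,\beta_0z)\ \text{ on } R_0,\qquad F(x,y,z)=\bigl(\tfrac34-\lambda_1x,\ \sigma(1-y),\ \beta_1(z-\tfrac56)\bigr)\ \text{ on } R_1,$$ and $F(X)\notin R$ for every $X\in R\setminus(R_0\cup R_1)$. Let $\Lambda=\bigcap_{n\in\mathbb Z}F^{-n}(R)$ be the maximal invariant set of $F$ in $R$, that is, the set of points with a full orbit $(X_n)_{n\in\mathbb Z}$, $F(X_n)=X_{n+1}$,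 contained in $R$. Let $E^c$ be the central direction, spanned by $(0,1,0)$, and let $Q=(0,0,0)$ and $P=(0,1,0)$, which are fixed points of $F$. Call $p\in\Lambda$ recurrent if it is an accumulation point of its forward orbit, i.e. $F^{n}(p)$ lies in each given neighbourhood of $p$ for infinitely many $n\ge 0$. By an ergodic measure we mean an ergodic $F$-invariant Borel probability measure $\mu$ with $\mu(\Lambda)=1$; its central Lyapunov exponent is $\lambda^c_\mu=\int\log\bigl|DF|_{E^c}\bigr|\,d\mu$. Then: 1. Every recurrent point $p\neq Q$ satisfies $$\liminf_{n\to+\infty}\frac1n\log\bigl|DF^n(p)|_{E^c}\bigr|\le 0,$$ and every ergodic measure $\mu\neq\delta_Q$ has $\lambda^c_\mu<0$. 2. If $(\mu_n)$ is a sequence of ergodic measures with $\lambda^c_{\mu_n}\to0$, then $\mu_n$ converges in the weak$^*$ topology to $\frac{\delta_Q+\delta_P}{2}$. -/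

import Mathlib

open MeasureTheory Filter Topology Set

namespace CentralHorseshoe

/-- The flow of the vector field `x' = x (1 - x)` on the interval `[0, 1]`
(see `centralFlow_zero` and `hasDerivAt_centralFlow`). -/
noncomputable def centralFlow (t y : ℝ) : ℝ :=
  y * Real.exp t / (1 - y + y * Real.exp t)

/-- The central map `f`, the time one map of the flow. -/
noncomputable def centralMap (y : ℝ) : ℝ := centralFlow 1 y

theorem centralFlow_zero (y : ℝ) : centralFlow 0 y = y := by
  simp [centralFlow]

theorem centralFlow_denom_pos {y : ℝ} (hy : y ∈ Icc (0 : ℝ) 1) (t : ℝ) :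
    0 < 1 - y + y * Real.exp t := by
  have h := Real.exp_pos t
  rcases eq_or_lt_of_le hy.1 with h0 | h0
  · rw [← h0]; norm_num
  · have := mul_pos h0 h
    linarith [hy.2]

theorem hasDerivAt_centralFlow {y : ℝ} (hy : y ∈ Icc (0 : ℝ) 1) (t : ℝ) :
    HasDerivAt (fun s => centralFlow s y) (centralFlow t y * (1 - centralFlow t y)) t := by
  have hd := (centralFlow_denom_pos hy t).ne'
  have h1 : HasDerivAt (fun s => y * Real.exp s) (y * Real.exp t) t :=
    (Real.hasDerivAt_exp t).const_mul y
  have h2 := h1.div (h1.const_add (1 - y)) hd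
  refine h2.congr_deriv ?_
  unfold centralFlow
  field_simp

/-- The cube `R = I³`.  Points are `(x, y, z)` with `x` the strong stable, `y` the central and
`z` the strong unstable coordinate. -/
def cube : Set (ℝ × ℝ × ℝ) := Icc 0 1 ×ˢ Icc 0 1 ×ˢ Icc 0 1

/-- The sub-cube `R₀`. -/
def cube0 : Set (ℝ × ℝ × ℝ) := Icc 0 1 ×ˢ Icc 0 1 ×ˢ Icc 0 (1 / 6)

/-- The sub-cube `R₁`. -/
def cube1 : Set (ℝ × ℝ × ℝ) := Icc 0 1 ×ˢ Icc 0 1 ×ˢ Icc (5 / 6) 1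

/-- The admissible parameters of the family. -/
structure Admissible (lam0 lam1 beta0 sig beta1 : ℝ) : Prop where
  lam0_pos : 0 < lam0
  lam0_lt : lam0 < 1 / 3
  lam1_pos : 0 < lam1
  lam1_lt : lam1 < 1 / 3
  lt_beta0 : 6 < beta0
  sig_pos : 0 < sig
  sig_lt : sig < 1 / 3
  lt_beta1 : 3 < beta1
  beta1_lt : beta1 < 4

/-- `F` is a horseshoe map of the family: it is given by the two explicit branches on `R₀` and
`R₁`, and the rest of the cube leaves the cube.  The map is written as a map of the ambient space;
its values outside the cube play no role.  Every (local) diffeomorphism of the ambient space with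
the last three properties satisfies the first two, which give a meaning to invariant measures
and to the derivative at the points of `R₀ ∪ R₁`. -/
structure IsHorseshoeMap (lam0 lam1 beta0 sig beta1 : ℝ) (F : ℝ × ℝ × ℝ → ℝ × ℝ × ℝ) : Prop where
  measurable : Measurable F
  differentiableAt : ∀ p ∈ cube0 ∪ cube1, DifferentiableAt ℝ F p
  branch0 : ∀ x y z : ℝ, (x, y, z) ∈ cube0 →
    F (x, y, z) = (lam0 * x, centralMap y, beta0 * z)
  branch1 : ∀ x y z : ℝ, (x, y, z) ∈ cube1 →
    F (x, y, z) = (3 / 4 - lam1 * x, sig * (1 - y), beta1 * (z - 5 / 6))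
  escape : ∀ p ∈ cube \ (cube0 ∪ cube1), F p ∉ cube

/-- The maximal invariant set `Λ = ⋂ n ∈ ℤ, F⁻ⁿ(R)`: the points with a full orbit in the cube. -/
def maxInvariantSet (F : ℝ × ℝ × ℝ → ℝ × ℝ × ℝ) : Set (ℝ × ℝ × ℝ) :=
  {p | ∃ o : ℤ → ℝ × ℝ × ℝ, o 0 = p ∧ (∀ n, o n ∈ cube) ∧ ∀ n, o (n + 1) = F (o n)}

/-- The fixed saddle `Q`. -/
def Q : ℝ × ℝ × ℝ := (0, 0, 0)

/-- The fixed saddle `P`. -/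
def P : ℝ × ℝ × ℝ := (0, 1, 0)

/-- `p` belongs to `Λ` and is accumulated by its own forward orbit. -/
def IsRecurrentPt (F : ℝ × ℝ × ℝ → ℝ × ℝ × ℝ) (p : ℝ × ℝ × ℝ) : Prop :=
  p ∈ maxInvariantSet F ∧ MapClusterPt p atTop (fun n : ℕ => F^[n] p)

/-- `|DG(p)|_{E^c}|`, where `E^c` is the line spanned by the unit vector `(0, 1, 0)`. -/
noncomputable def centralNorm (G : ℝ × ℝ × ℝ → ℝ × ℝ × ℝ) (p : ℝ × ℝ × ℝ) : ℝ :=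
  ‖fderiv ℝ G p (0, 1, 0)‖

/-- `μ` is an ergodic `F`-invariant probability measure (carried by `Λ`). -/
def IsErgodicMeasure (F : ℝ × ℝ × ℝ → ℝ × ℝ × ℝ) (μ : ProbabilityMeasure (ℝ × ℝ × ℝ)) : Prop :=
  (∀ᵐ p ∂(μ : Measure (ℝ × ℝ × ℝ)), p ∈ maxInvariantSet F) ∧
    Ergodic F (μ : Measure (ℝ × ℝ × ℝ))

/-- The central Lyapunov exponent `∫ log |DF|_{E^c}| dμ`. -/
noncomputable def centralExponent (F : ℝ × ℝ × ℝ → ℝ × ℝ × ℝ)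
    (μ : ProbabilityMeasure (ℝ × ℝ × ℝ)) : ℝ :=
  ∫ p, Real.log (centralNorm F p) ∂(μ : Measure (ℝ × ℝ × ℝ))

/-- The probability measure `(δ_Q + δ_P) / 2`. -/
noncomputable def halfDirac : ProbabilityMeasure (ℝ × ℝ × ℝ) :=
  ⟨(2 : ENNReal)⁻¹ • (Measure.dirac Q + Measure.dirac P), ⟨by
    simp only [Measure.smul_apply, Measure.add_apply, measure_univ, smul_eq_mul]
    rw [one_add_one_eq_two]
    exact ENNReal.inv_mul_cancel (by norm_num) (by norm_num)⟩⟩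

end CentralHorseshoe

/-! Since `f` is the time-one map of the field v(y) = y(1 - y), its derivative is f'(y) = v(f(y)) /
v(y). So on R₀ the logarithm of the central derivative is exactly the coboundary of log v(y). On R₁
the map y ↦ σ(1 - y) satisfies only an inequality: log σ + (1 - σ)(1 - y) is at most the increment
of log v. The central exponent is thus bounded by a coboundary, with a defect at each visit to R₁
(`log_rate_le_coboundary`). Because log v ≤ 0, the logarithm of the derivative is bounded above
along every orbit that enters 0 < y < 1. The orbits that stay on y = 0 or y = 1 are treated
directly.

An ergodic measure is δ_Q, δ_P or carried by 0 < y < 1 (`ergodic_trichotomy`). In the last case,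
integrating the inequality gives λ + (1 - σ) t ≤ 0, where t is the integral of 1 - y over R₁. If t
is small, visits to R₁ occur mostly near y = 1. They land near y = 0, and a long passage through R₀
is needed before 1 - y is small again, so the mass m of R₁ is small too (`mul_integral_turn_le`).
The integrals of x, z and y(1 - y) are O(m), because each of these functions is dominated by a
coboundary off R₁. Hence λ ≥ 0 would force t = m = 0 and y(1 - y) = 0 almost everywhere, which is
absurd.

If λ → 0, then t → 0 and m → 0, so the measures concentrate on {Q, P}. The weights follow from λ = 1
- 2∫y + O(m), which gives ∫y → 1/2. -/

namespace CentralHorseshoe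

/-! ### Integration of coboundary inequalities -/

/-- A lower bound of a coboundary has nonpositive integral, even if the transfer function is not
integrable. -/
theorem integral_nonpos_of_le_coboundary {α : Type*} [MeasurableSpace α] {μ : Measure α}
    [IsProbabilityMeasure μ] {T : α → α} (hT : MeasurePreserving T μ μ) {h k : α → ℝ}
    (hh : Measurable h) (hk : Integrable k μ) (hle : ∀ᵐ a ∂μ, k a ≤ h (T a) - h a) :
    ∫ a, k a ∂μ ≤ 0 := by
  let c : ℕ → ℝ → ℝ := fun M s => max (-(M : ℝ)) (min M s)
  have hcm : ∀ M, Measurable (c M) := fun M => by fun_prop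
  have hcb : ∀ M s, |c M s| ≤ M := fun M s => by
    have : (0 : ℝ) ≤ M := Nat.cast_nonneg M
    exact abs_le.2 ⟨le_max_left _ _, max_le (by linarith) (min_le_left _ _)⟩
  have hci : ∀ M, Integrable (fun a => c M (h a)) μ := fun M =>
    Integrable.of_bound ((hcm M).comp hh).aestronglyMeasurable M
      (Eventually.of_forall fun a => hcb M _)
  have hciT : ∀ M, Integrable (fun a => c M (h (T a))) μ := fun M =>
    Integrable.of_bound ((hcm M).comp (hh.comp hT.measurable)).aestronglyMeasurable M
      (Eventually.of_forall fun a => hcb M _)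
  have hz : ∀ M, ∫ a, (c M (h (T a)) - c M (h a)) ∂μ = 0 := fun M => by
    rw [integral_sub (hciT M) (hci M), sub_eq_zero]
    have := integral_map (μ := μ) hT.measurable.aemeasurable (f := fun a => c M (h a))
      ((hcm M).comp hh).aestronglyMeasurable
    rw [hT.map_eq] at this
    exact this.symm
  have hlip : ∀ M s t, min (t - s) 0 ≤ c M t - c M s := fun M s t => by
    rcases le_total s t with hst | hst
    · have : c M s ≤ c M t := max_le_max le_rfl (min_le_min le_rfl hst)
      exact (min_le_right _ _).trans (sub_nonneg.2 this)
    · refine (min_le_left _ _).trans ?_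
      have : c M s ≤ c M t + (s - t) := by
        refine max_le ?_ ?_
        · linarith [le_max_left (-(M : ℝ)) (min (M : ℝ) t)]
        · have h1 := le_max_right (-(M : ℝ)) (min (M : ℝ) t)
          have h2 : min (M : ℝ) s ≤ min (M : ℝ) t + (s - t) := by
            rcases le_total (M : ℝ) t with h | h
            · rw [min_eq_left h]; linarith [min_le_left (M : ℝ) s]
            · rw [min_eq_right h]; linarith [min_le_right (M : ℝ) s]
          linarith
      linarith
  have hev : ∀ s, ∀ᶠ M : ℕ in atTop, c M s = s := fun s => by
    obtain ⟨N, hN⟩ := exists_nat_ge |s|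
    filter_upwards [eventually_ge_atTop N] with M hM
    have : |s| ≤ M := hN.trans (by exact_mod_cast hM)
    have := abs_le.1 this
    simp only [c]
    rw [min_eq_right this.2, max_eq_right this.1]
  -- The transfer function is truncated to [-M, M]. Truncation is monotone and 1-Lipschitz, so the
  -- truncated coboundary is at least min(h ∘ T - h, 0) ≥ -|k|. Its minimum with k is then dominated
  -- by |k| and converges to k, while each truncated coboundary has integral zero.
  have hlim : Tendsto (fun M : ℕ => ∫ a, min (k a) (c M (h (T a)) - c M (h a)) ∂μ) atTop
      (𝓝 (∫ a, k a ∂μ)) := by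
    refine tendsto_integral_of_dominated_convergence (fun a => |k a|) ?_ hk.abs ?_ ?_
    · exact fun M => (hk.inf ((hciT M).sub (hci M))).aestronglyMeasurable
    · intro M
      filter_upwards [hle] with a ha
      rw [Real.norm_eq_abs, abs_le]
      refine ⟨le_min (neg_abs_le _) ?_, (min_le_left _ _).trans (le_abs_self _)⟩
      refine le_trans (le_min ?_ ?_) (hlip M (h a) (h (T a)))
      · exact (neg_abs_le _).trans ha
      · exact neg_nonpos.2 (abs_nonneg _)
    · filter_upwards [hle] with a ha
      refine tendsto_const_nhds.congr' ?_
      filter_upwards [hev (h a), hev (h (T a))] with M h1 h2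
      rw [h1, h2, min_eq_left ha]
  refine le_of_tendsto' hlim fun M => ?_
  rw [← hz M]
  exact integral_mono (hk.inf ((hciT M).sub (hci M))) ((hciT M).sub (hci M))
    fun a => min_le_right _ _

/-! ### The central derivative along orbits -/

/-- The central derivative of the horseshoe map on `R₀ ∪ R₁`. -/
noncomputable def centralRate (sig : ℝ) (p : ℝ × ℝ × ℝ) : ℝ :=
  if p.2.2 ≤ 1 / 6 then Real.exp 1 / (1 - p.2.1 + p.2.1 * Real.exp 1) ^ 2 else -sig

/-- The indicator of `R₁` in `R₀ ∪ R₁`. -/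
noncomputable def turn (p : ℝ × ℝ × ℝ) : ℝ := if p.2.2 ≤ 1 / 6 then 0 else 1

theorem hasDerivAt_centralMap {y : ℝ} (hy : y ∈ Icc (0 : ℝ) 1) :
    HasDerivAt centralMap (Real.exp 1 / (1 - y + y * Real.exp 1) ^ 2) y := by
  have hd := (centralFlow_denom_pos hy 1).ne'
  have h1 : HasDerivAt (fun s : ℝ => s * Real.exp 1) (1 * Real.exp 1) y :=
    (hasDerivAt_id y).mul_const _
  have h2 := h1.div (((hasDerivAt_id y).const_sub 1).add h1) hd
  refine h2.congr_deriv ?_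
  simp only [Pi.add_apply, id]
  congr 1
  ring

section Branches

variable {lam0 lam1 beta0 sig beta1 : ℝ} {F : ℝ × ℝ × ℝ → ℝ × ℝ × ℝ}

theorem IsHorseshoeMap.cases (hF : IsHorseshoeMap lam0 lam1 beta0 sig beta1 F) {p : ℝ × ℝ × ℝ}
    (hp : p ∈ cube0 ∪ cube1) :
    p.1 ∈ Icc (0 : ℝ) 1 ∧ p.2.1 ∈ Icc (0 : ℝ) 1 ∧ p.2.2 ∈ Icc (0 : ℝ) 1 ∧
    ((p.2.2 ≤ 1 / 6 ∧ F p = (lam0 * p.1, centralMap p.2.1, beta0 * p.2.2)) ∨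
      (¬ p.2.2 ≤ 1 / 6 ∧ 5 / 6 ≤ p.2.2 ∧
        F p = (3 / 4 - lam1 * p.1, sig * (1 - p.2.1), beta1 * (p.2.2 - 5 / 6)))) := by
  obtain ⟨x, y, z⟩ := p
  rcases hp with hp | hp
  · have hb := hF.branch0 x y z hp
    obtain ⟨h1, h2, h3⟩ := hp
    exact ⟨h1, h2, ⟨h3.1, h3.2.trans (by norm_num)⟩, Or.inl ⟨h3.2, hb⟩⟩
  · have hb := hF.branch1 x y z hp
    obtain ⟨h1, h2, h3⟩ := hp
    have h4 : (5 : ℝ) / 6 ≤ z := h3.1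
    exact ⟨h1, h2, ⟨le_trans (by norm_num) h4, h3.2⟩,
      Or.inr ⟨not_le.2 (lt_of_lt_of_le (by norm_num) h4), h4, hb⟩⟩

/-- The branch formulas hold only inside the cube, so at y = 0 or y = 1 they give a one-sided
derivative. Differentiability of the ambient map and uniqueness of derivatives within [0, 1] turn
this into the full central derivative. -/
theorem fderiv_central_of_eq {G : ℝ × ℝ × ℝ → ℝ × ℝ × ℝ} {p : ℝ × ℝ × ℝ}
    (hG : DifferentiableAt ℝ G p) (hp : p.2.1 ∈ Icc (0 : ℝ) 1) {a b d : ℝ} {g : ℝ → ℝ}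
    (hg : HasDerivAt g d p.2.1)
    (hGg : ∀ y ∈ Icc (0 : ℝ) 1, G (p.1, y, p.2.2) = (a, g y, b)) :
    fderiv ℝ G p (0, 1, 0) = (0, d, 0) := by
  have hline : HasDerivAt (fun y : ℝ => (p.1, y, p.2.2)) ((0, 1, 0) : ℝ × ℝ × ℝ) p.2.1 :=
    (hasDerivAt_const _ _).prodMk ((hasDerivAt_id _).prodMk (hasDerivAt_const _ _))
  have h1 : HasDerivAt (fun y : ℝ => G (p.1, y, p.2.2)) (fderiv ℝ G p (0, 1, 0)) p.2.1 :=
    HasFDerivAt.comp_hasDerivAt (f := fun y : ℝ => (p.1, y, p.2.2)) _ hG.hasFDerivAt hline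
  have h2 : HasDerivAt (fun y : ℝ => (a, g y, b)) ((0, d, 0) : ℝ × ℝ × ℝ) p.2.1 :=
    (hasDerivAt_const _ _).prodMk (hg.prodMk (hasDerivAt_const _ _))
  have hu : UniqueDiffWithinAt ℝ (Icc (0 : ℝ) 1) p.2.1 := uniqueDiffOn_Icc_zero_one _ hp
  exact hu.eq_deriv _ h1.hasDerivWithinAt (h2.hasDerivWithinAt.congr hGg (hGg _ hp))

theorem IsHorseshoeMap.fderiv_central (hF : IsHorseshoeMap lam0 lam1 beta0 sig beta1 F)
    {p : ℝ × ℝ × ℝ} (hp : p ∈ cube0 ∪ cube1) :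
    fderiv ℝ F p (0, 1, 0) = (0, centralRate sig p, 0) := by
  have hd := hF.differentiableAt p hp
  obtain ⟨x, y, z⟩ := p
  rcases hp with ⟨hx, hy, hz⟩ | ⟨hx, hy, hz⟩
  · have : z ≤ 1 / 6 := hz.2
    rw [centralRate, if_pos this]
    exact fderiv_central_of_eq hd hy (hasDerivAt_centralMap hy)
      fun y hy => hF.branch0 x y z ⟨hx, hy, hz⟩
  · have h5 : (5 : ℝ) / 6 ≤ z := hz.1
    have : ¬ z ≤ 1 / 6 := not_le.2 (lt_of_lt_of_le (by norm_num) h5)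
    rw [centralRate, if_neg this]
    have hg : HasDerivAt (fun y : ℝ => sig * (1 - y)) (-sig) y := by
      simpa using ((hasDerivAt_id y).const_sub 1).const_mul sig
    exact fderiv_central_of_eq hd hy hg fun y hy => hF.branch1 x y z ⟨hx, hy, hz⟩

theorem norm_central (d : ℝ) : ‖((0, d, 0) : ℝ × ℝ × ℝ)‖ = |d| := by
  simp [Prod.norm_def]

theorem IsHorseshoeMap.centralNorm_eq (hF : IsHorseshoeMap lam0 lam1 beta0 sig beta1 F)
    {p : ℝ × ℝ × ℝ} (hp : p ∈ cube0 ∪ cube1) : centralNorm F p = |centralRate sig p| := by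
  rw [centralNorm, hF.fderiv_central hp, norm_central]

theorem centralRate_ne_zero (hs : 0 < sig) {p : ℝ × ℝ × ℝ} (hp : p.2.1 ∈ Icc (0 : ℝ) 1) :
    centralRate sig p ≠ 0 := by
  unfold centralRate
  split_ifs
  · exact (div_pos (Real.exp_pos 1) (pow_pos (centralFlow_denom_pos hp 1) 2)).ne'
  · exact neg_ne_zero.2 hs.ne'

theorem IsHorseshoeMap.fderiv_iterate_central
    (hF : IsHorseshoeMap lam0 lam1 beta0 sig beta1 F) {p : ℝ × ℝ × ℝ}
    (hp : ∀ n : ℕ, F^[n] p ∈ cube0 ∪ cube1) (n : ℕ) :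
    DifferentiableAt ℝ F^[n] p ∧ fderiv ℝ F^[n] p (0, 1, 0) =
      (0, ∏ i ∈ Finset.range n, centralRate sig (F^[i] p), 0) := by
  induction n with
  | zero => simp [differentiableAt_id]
  | succ n ih =>
    have hd := hF.differentiableAt _ (hp n)
    rw [Function.iterate_succ']
    refine ⟨hd.comp p ih.1, ?_⟩
    rw [fderiv_comp p hd ih.1, ContinuousLinearMap.comp_apply, ih.2]
    have : ((0, ∏ i ∈ Finset.range n, centralRate sig (F^[i] p), 0) : ℝ × ℝ × ℝ) =
        (∏ i ∈ Finset.range n, centralRate sig (F^[i] p)) • ((0, 1, 0) : ℝ × ℝ × ℝ) := by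
      simp
    rw [this, map_smul, hF.fderiv_central (hp n), Finset.prod_range_succ]
    simp

theorem IsHorseshoeMap.log_centralNorm_iterate
    (hF : IsHorseshoeMap lam0 lam1 beta0 sig beta1 F) (hs : 0 < sig) {p : ℝ × ℝ × ℝ}
    (hp : ∀ n : ℕ, F^[n] p ∈ cube0 ∪ cube1) (n : ℕ) :
    Real.log (centralNorm F^[n] p) =
      ∑ i ∈ Finset.range n, Real.log |centralRate sig (F^[i] p)| := by
  rw [centralNorm, (hF.fderiv_iterate_central hp n).2, norm_central, Finset.abs_prod,
    Real.log_prod]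
  exact fun i _ => abs_ne_zero.2 (centralRate_ne_zero hs (hF.cases (hp i)).2.1)

end Branches

/-! ### One-dimensional estimates for the two central branches -/

theorem centralMap_eq (y : ℝ) :
    centralMap y = y * Real.exp 1 / (1 - y + y * Real.exp 1) := rfl

theorem one_sub_centralMap {y : ℝ} (hy : y ∈ Icc (0 : ℝ) 1) :
    1 - centralMap y = (1 - y) / (1 - y + y * Real.exp 1) := by
  have := (centralFlow_denom_pos hy 1).ne'
  rw [centralMap_eq]
  field_simp
  ring

theorem centralMap_mem_Ioo {y : ℝ} (hy : y ∈ Ioo (0 : ℝ) 1) : centralMap y ∈ Ioo (0 : ℝ) 1 := by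
  have hy' := Ioo_subset_Icc_self hy
  have hD := centralFlow_denom_pos hy' 1
  have h1 := one_sub_centralMap hy'
  have h2 : 0 < 1 - centralMap y := by rw [h1]; exact div_pos (by linarith [hy.2]) hD
  refine ⟨?_, by linarith⟩
  rw [centralMap_eq]
  exact div_pos (mul_pos hy.1 (Real.exp_pos 1)) hD

theorem denom_mem_Icc {y : ℝ} (hy : y ∈ Icc (0 : ℝ) 1) :
    1 - y + y * Real.exp 1 ∈ Icc 1 (Real.exp 1) := by
  have he : (1 : ℝ) ≤ Real.exp 1 := Real.one_le_exp (by norm_num)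
  constructor <;> nlinarith [hy.1, hy.2]

theorem log_rate_centralMap {y : ℝ} (hy : y ∈ Icc (0 : ℝ) 1) :
    Real.log |Real.exp 1 / (1 - y + y * Real.exp 1) ^ 2| =
      1 - 2 * Real.log (1 - y + y * Real.exp 1) := by
  have hD := centralFlow_denom_pos hy 1
  rw [Real.log_abs, Real.log_div (Real.exp_pos 1).ne' (pow_pos hD 2).ne', Real.log_exp,
    Real.log_pow]
  norm_num

theorem log_denom_mem_Icc {y : ℝ} (hy : y ∈ Icc (0 : ℝ) 1) :
    Real.log (1 - y + y * Real.exp 1) ∈ Icc 0 1 := by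
  obtain ⟨h1, h2⟩ := denom_mem_Icc hy
  refine ⟨Real.log_nonneg h1, ?_⟩
  have := Real.log_le_log (by linarith) h2
  rwa [Real.log_exp] at this

/-- A flow carries its vector field to itself: v(f(y)) = f'(y) v(y) with v(y) = y(1 - y). -/
theorem log_centralMap_mul {y : ℝ} (hy : y ∈ Ioo (0 : ℝ) 1) :
    Real.log (centralMap y * (1 - centralMap y)) - Real.log (y * (1 - y)) =
      1 - 2 * Real.log (1 - y + y * Real.exp 1) := by
  have hy' := Ioo_subset_Icc_self hy
  have hD := centralFlow_denom_pos hy' 1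
  have hv : 0 < y * (1 - y) := mul_pos hy.1 (by linarith [hy.2])
  rw [one_sub_centralMap hy', ← log_rate_centralMap hy', Real.log_abs, sub_eq_iff_eq_add,
    ← Real.log_mul (div_pos (Real.exp_pos 1) (pow_pos hD 2)).ne' hv.ne', centralMap_eq]
  congr 1
  field_simp

theorem log_turn_mul {sig y : ℝ} (hs : 0 < sig) (hs1 : sig < 1) (hy : y ∈ Ioo (0 : ℝ) 1) :
    Real.log sig + (1 - sig) * (1 - y) ≤
      Real.log (sig * (1 - y) * (1 - sig * (1 - y))) - Real.log (y * (1 - y)) := by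
  have h1 : 0 < 1 - y := by linarith [hy.2]
  have hE : 0 < 1 - sig * (1 - y) := by nlinarith [hy.1]
  rw [Real.log_mul (mul_pos hs h1).ne' hE.ne', Real.log_mul hs.ne' h1.ne',
    Real.log_mul hy.1.ne' h1.ne']
  have h2 := Real.log_le_sub_one_of_pos (div_pos hy.1 hE)
  rw [Real.log_div hy.1.ne' hE.ne'] at h2
  -- With E = 1 - σ(1 - y) one has E - y = (1 - σ)(1 - y), and E ≤ 1, so 1 - y/E ≥ (1 - σ)(1 - y).
  have h3 : y / (1 - sig * (1 - y)) - 1 ≤ -((1 - sig) * (1 - y)) := by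
    rw [sub_le_iff_le_add, div_le_iff₀ hE]
    nlinarith [mul_nonneg (mul_nonneg (sub_nonneg.2 hs1.le) hs.le) (mul_nonneg h1.le h1.le)]
  linarith

/-- Here f(y) - y = (e - 1) y(1 - y) / D with D = 1 - y + ye ≤ e, and (e - 1)/e ≥ 1/2. -/
theorem centralMap_sub_self_ge {y : ℝ} (hy : y ∈ Icc (0 : ℝ) 1) :
    1 / 2 * (y * (1 - y)) ≤ centralMap y - y := by
  have hD := centralFlow_denom_pos hy 1
  have he : (2 : ℝ) ≤ Real.exp 1 := by linarith [Real.add_one_le_exp (1 : ℝ)]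
  have hv : 0 ≤ y * (1 - y) := mul_nonneg hy.1 (by linarith [hy.2])
  rw [centralMap_eq, le_sub_iff_add_le, le_div_iff₀ hD]
  nlinarith [mul_nonneg hv (by linarith [(denom_mem_Icc hy).2] :
    0 ≤ Real.exp 1 - (1 - y + y * Real.exp 1)), mul_nonneg hv (sub_nonneg.2 he)]

/-- Replaces log f'(y) = 1 - 2 log D by the affine function 1 - 2y, with which it agrees at the two
fixed points. Convexity of exp gives y ≤ log D. The upper bound uses log D ≤ (e - 1)y for y ≤ 1/2
and log D ≤ 1 for y ≥ 1/2. -/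
theorem abs_log_denom_sub_le {y : ℝ} (hy : y ∈ Icc (0 : ℝ) 1) :
    |Real.log (1 - y + y * Real.exp 1) - y| ≤ 2 * (y * (1 - y)) := by
  have hD := centralFlow_denom_pos hy 1
  have hlow : y ≤ Real.log (1 - y + y * Real.exp 1) := by
    rw [Real.le_log_iff_exp_le hD]
    have := convexOn_exp.2 (mem_univ (0 : ℝ)) (mem_univ (1 : ℝ)) (sub_nonneg.2 hy.2) hy.1
      (by ring)
    simpa using this
  have he := Real.exp_one_lt_d9
  have he' : (1 : ℝ) ≤ Real.exp 1 := Real.one_le_exp (by norm_num)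
  have hup1 := Real.log_le_sub_one_of_pos hD
  have hup2 := Real.log_le_sub_one_of_pos (div_pos hD (Real.exp_pos 1))
  rw [Real.log_div hD.ne' (Real.exp_pos 1).ne', Real.log_exp] at hup2
  have h3 : (1 - y + y * Real.exp 1) / Real.exp 1 ≤ 1 := (div_le_one (Real.exp_pos 1)).2
    (denom_mem_Icc hy).2
  have h4 : (1 - y + y * Real.exp 1) / Real.exp 1 ≤ (1 - y) + y := by
    rw [div_le_iff₀ (Real.exp_pos 1)]
    nlinarith [hy.1, hy.2]
  rw [abs_of_nonneg (by linarith)]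
  rcases le_total y (1 / 2) with h | h
  · nlinarith [hy.1, hy.2]
  · nlinarith [hy.1, hy.2]

end CentralHorseshoe

/-! ### Invariant measures: classification and integral inequalities -/

namespace CentralHorseshoe

theorem measurable_turn : Measurable turn :=
  Measurable.ite (measurableSet_le (by fun_prop) measurable_const) measurable_const
    measurable_const

theorem measurable_centralRate (sig : ℝ) : Measurable (centralRate sig) :=
  Measurable.ite (measurableSet_le (by fun_prop) measurable_const) (by fun_prop)
    measurable_const

theorem turn_mem_Icc (p : ℝ × ℝ × ℝ) : turn p ∈ Icc (0 : ℝ) 1 := by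
  unfold turn
  split_ifs <;> norm_num

theorem eq_dirac_of_ae_eq {α : Type*} [MeasurableSpace α] [MeasurableSingletonClass α]
    {μ : Measure α} [IsProbabilityMeasure μ] {a : α} (h : ∀ᵐ x ∂μ, x = a) :
    μ = Measure.dirac a := by
  ext s hs
  rw [Measure.dirac_apply' a hs]
  by_cases ha : a ∈ s
  · rw [indicator_of_mem ha, Pi.one_apply, ← mem_ae_iff_prob_eq_one hs]
    filter_upwards [h] with x hx
    rwa [hx]
  · rw [indicator_of_notMem ha, measure_eq_zero_iff_ae_notMem]
    filter_upwards [h] with x hx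
    rwa [hx]

section Invariant

variable {lam0 lam1 beta0 sig beta1 : ℝ} {F : ℝ × ℝ × ℝ → ℝ × ℝ × ℝ}

theorem IsHorseshoeMap.mem_of_mem_cube (hF : IsHorseshoeMap lam0 lam1 beta0 sig beta1 F)
    {p : ℝ × ℝ × ℝ} (hp : p ∈ cube) (hFp : F p ∈ cube) : p ∈ cube0 ∪ cube1 := by
  by_contra h
  exact hF.escape p ⟨hp, h⟩ hFp

theorem IsHorseshoeMap.iterate_mem (hF : IsHorseshoeMap lam0 lam1 beta0 sig beta1 F)
    {p : ℝ × ℝ × ℝ} (hp : p ∈ maxInvariantSet F) (n : ℕ) : F^[n] p ∈ cube0 ∪ cube1 := by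
  obtain ⟨o, rfl, ho, hs⟩ := hp
  have hn : ∀ n : ℕ, F^[n] (o 0) = o n := by
    intro n
    induction n with
    | zero => rfl
    | succ n ih => rw [Function.iterate_succ_apply', ih, ← hs]; norm_cast
  rw [hn]
  exact hF.mem_of_mem_cube (ho n) (hs n ▸ ho _)

variable {μ : Measure (ℝ × ℝ × ℝ)} [IsProbabilityMeasure μ]

/-- An invariant measure concentrated at a constant central coordinate and on `R₀` is the Dirac
mass on the corresponding fixed point. -/
theorem IsHorseshoeMap.eq_dirac (hpar : Admissible lam0 lam1 beta0 sig beta1)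
    (hF : IsHorseshoeMap lam0 lam1 beta0 sig beta1 F) (hT : MeasurePreserving F μ μ)
    (hμ : ∀ᵐ p ∂μ, p ∈ cube0 ∪ cube1) {c : ℝ}
    (hc : ∀ᵐ p ∂μ, p.2.2 ≤ 1 / 6 ∧ p.2.1 = c) : μ = Measure.dirac (0, c, 0) := by
  have hm : Measurable fun p : ℝ × ℝ × ℝ => p.1 + p.2.2 := by fun_prop
  have hpos : 0 ≤ᵐ[μ] fun p : ℝ × ℝ × ℝ => p.1 + p.2.2 := by
    filter_upwards [hμ] with p hp
    obtain ⟨hx, -, hz, -⟩ := hF.cases hp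
    exact add_nonneg hx.1 hz.1
  have hi : Integrable (fun p : ℝ × ℝ × ℝ => p.1 + p.2.2) μ := by
    refine Integrable.of_bound hm.aestronglyMeasurable 2 ?_
    filter_upwards [hμ] with p hp
    obtain ⟨hx, -, hz, -⟩ := hF.cases hp
    rw [Real.norm_eq_abs, abs_le]
    constructor <;> linarith [hx.1, hx.2, hz.1, hz.2]
  -- On R₀ the coordinate z expands and x contracts, so z - x increases by at least (x + z)/2.
  have h0 : ∫ p : ℝ × ℝ × ℝ, (1 / 2) * (p.1 + p.2.2) ∂μ ≤ 0 := by
    refine integral_nonpos_of_le_coboundary (h := fun p => p.2.2 - p.1) hT (by fun_prop)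
      (hi.const_mul _) ?_
    filter_upwards [hμ, hc] with p hp hpc
    obtain ⟨hx, -, hz, h | h⟩ := hF.cases hp
    · rw [h.2]
      nlinarith [hpar.lam0_lt, hpar.lt_beta0, hx.1, hz.1]
    · exact absurd hpc.1 h.1
  rw [integral_const_mul] at h0
  have h1 : ∫ p : ℝ × ℝ × ℝ, (p.1 + p.2.2) ∂μ = 0 :=
    le_antisymm (by linarith) (integral_nonneg_of_ae hpos)
  rw [integral_eq_zero_iff_of_nonneg_ae hpos hi] at h1
  refine eq_dirac_of_ae_eq ?_
  filter_upwards [h1, hμ, hc] with p hp1 hp hpc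
  obtain ⟨hx, -, hz, -⟩ := hF.cases hp
  have hp1' : p.1 + p.2.2 = 0 := hp1
  ext
  · show p.1 = 0
    linarith [hx.1, hz.1]
  · exact hpc.2
  · show p.2.2 = 0
    linarith [hx.1, hz.1]

theorem IsHorseshoeMap.snd_lt_one (hpar : Admissible lam0 lam1 beta0 sig beta1)
    (hF : IsHorseshoeMap lam0 lam1 beta0 sig beta1 F) {p : ℝ × ℝ × ℝ} (hp : p ∈ cube0 ∪ cube1)
    (h : p.2.1 < 1) : (F p).2.1 < 1 := by
  obtain ⟨-, hy, -, hb | hb⟩ := hF.cases hp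
  · rw [hb.2]
    have h1 := one_sub_centralMap hy
    have h2 := div_pos (sub_pos.2 h) (centralFlow_denom_pos hy 1)
    show centralMap p.2.1 < 1
    linarith
  · rw [hb.2.2]
    show sig * (1 - p.2.1) < 1
    nlinarith [hy.1, hpar.sig_pos, hpar.sig_lt]

theorem IsHorseshoeMap.snd_mem_Ioo (hpar : Admissible lam0 lam1 beta0 sig beta1)
    (hF : IsHorseshoeMap lam0 lam1 beta0 sig beta1 F) {p : ℝ × ℝ × ℝ} (hp : p ∈ cube0 ∪ cube1)
    (h : p.2.1 ∈ Ioo (0 : ℝ) 1) : (F p).2.1 ∈ Ioo (0 : ℝ) 1 := by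
  refine ⟨?_, hF.snd_lt_one hpar hp h.2⟩
  obtain ⟨-, hy, -, hb | hb⟩ := hF.cases hp
  · rw [hb.2]
    exact (centralMap_mem_Ioo h).1
  · rw [hb.2.2]
    exact mul_pos hpar.sig_pos (sub_pos.2 h.2)

/-- The preimage of {y = 1} lies in {y = 1} almost everywhere, so ergodicity makes this set null or
full. The same holds for {y = 0} once {y = 1} is null; the order matters, because R₁ sends y = 1 to
y = 0. A full plane carries only orbits in R₀, hence only the Dirac mass at its fixed point. -/
theorem IsHorseshoeMap.ergodic_trichotomy (hpar : Admissible lam0 lam1 beta0 sig beta1)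
    (hF : IsHorseshoeMap lam0 lam1 beta0 sig beta1 F) (hE : Ergodic F μ)
    (hμ : ∀ᵐ p ∂μ, p ∈ cube0 ∪ cube1) :
    μ = Measure.dirac Q ∨ μ = Measure.dirac P ∨ ∀ᵐ p ∂μ, p.2.1 ∈ Ioo (0 : ℝ) 1 := by
  have hT := hE.toMeasurePreserving
  have hms : ∀ c : ℝ, MeasurableSet {p : ℝ × ℝ × ℝ | p.2.1 = c} := fun c =>
    measurableSet_eq_fun (by fun_prop) measurable_const
  have key : ∀ c : ℝ, (∀ᵐ p ∂μ, (F p).2.1 = c → p.2.1 = c) →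
      (∀ p : ℝ × ℝ × ℝ, p ∈ cube0 ∪ cube1 → p.2.1 = c → (F p).2.1 = c → p.2.2 ≤ 1 / 6) →
      (∀ᵐ p ∂μ, p.2.1 ≠ c) ∨ μ = Measure.dirac (0, c, 0) := by
    intro c h1 h2
    rcases hE.ae_empty_or_univ_of_preimage_ae_le (hms c).nullMeasurableSet h1 with h | h
    · left
      rw [ae_eq_empty] at h
      exact measure_eq_zero_iff_ae_notMem.1 h
    · right
      rw [ae_eq_univ] at h
      have h' : ∀ᵐ p ∂μ, p.2.1 = c := h
      refine hF.eq_dirac hpar hT hμ ?_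
      filter_upwards [h', hμ, hT.quasiMeasurePreserving.ae h'] with p a b d
      exact ⟨h2 p b a d, a⟩
  have k1 := key 1 (by
      filter_upwards [hμ] with p hp hFp
      by_contra hne
      have := hF.snd_lt_one hpar hp (lt_of_le_of_ne (hF.cases hp).2.1.2 hne)
      exact this.ne hFp) (by
      intro p hp h1 h2
      obtain ⟨-, hy, -, hb | hb⟩ := hF.cases hp
      · exact hb.1
      · rw [hb.2.2, h1] at h2
        norm_num at h2)
  rcases k1 with h1 | h1
  swap
  · exact Or.inr (Or.inl h1)
  have k0 := key 0 (by
      filter_upwards [hμ, h1] with p hp hp1 hFp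
      by_contra hne
      have hy := (hF.cases hp).2.1
      have := hF.snd_mem_Ioo hpar hp
        ⟨lt_of_le_of_ne hy.1 (Ne.symm hne), lt_of_le_of_ne hy.2 hp1⟩
      exact this.1.ne' hFp) (by
      intro p hp h1 h2
      obtain ⟨-, hy, -, hb | hb⟩ := hF.cases hp
      · exact hb.1
      · rw [hb.2.2, h1] at h2
        have := hpar.sig_pos
        norm_num at h2
        exact absurd h2 this.ne')
  rcases k0 with h0 | h0
  · refine Or.inr (Or.inr ?_)
    filter_upwards [hμ, h0, h1] with p hp hp0 hp1
    have hy := (hF.cases hp).2.1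
    exact ⟨lt_of_le_of_ne hy.1 (Ne.symm hp0), lt_of_le_of_ne hy.2 hp1⟩
  · exact Or.inl h0

theorem IsHorseshoeMap.integrable_of_bound (hF : IsHorseshoeMap lam0 lam1 beta0 sig beta1 F)
    (hμ : ∀ᵐ p ∂μ, p ∈ cube0 ∪ cube1) {u : ℝ × ℝ × ℝ → ℝ} (hu : Measurable u) (C : ℝ)
    (hC : ∀ p : ℝ × ℝ × ℝ, p.1 ∈ Icc (0 : ℝ) 1 → p.2.1 ∈ Icc (0 : ℝ) 1 → p.2.2 ∈ Icc (0 : ℝ) 1 →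
      |u p| ≤ C) : Integrable u μ := by
  refine Integrable.of_bound hu.aestronglyMeasurable C ?_
  filter_upwards [hμ] with p hp
  obtain ⟨hx, hy, hz, -⟩ := hF.cases hp
  exact hC p hx hy hz

theorem IsHorseshoeMap.integrable_turn (hF : IsHorseshoeMap lam0 lam1 beta0 sig beta1 F)
    (hμ : ∀ᵐ p ∂μ, p ∈ cube0 ∪ cube1) : Integrable turn μ :=
  hF.integrable_of_bound hμ measurable_turn 1 fun p _ _ _ =>
    abs_le.2 ⟨by linarith [(turn_mem_Icc p).1], (turn_mem_Icc p).2⟩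

theorem mul_mem_Icc_zero_one {a b : ℝ} (ha : a ∈ Icc (0 : ℝ) 1) (hb : b ∈ Icc (0 : ℝ) 1) :
    a * b ∈ Icc (0 : ℝ) 1 :=
  ⟨mul_nonneg ha.1 hb.1, mul_le_one₀ ha.2 hb.1 hb.2⟩

theorem abs_le_one_of_mem {a : ℝ} (ha : a ∈ Icc (0 : ℝ) 1) : |a| ≤ 1 :=
  abs_le.2 ⟨by linarith [ha.1], ha.2⟩

theorem IsHorseshoeMap.integrable_turn_mul (hF : IsHorseshoeMap lam0 lam1 beta0 sig beta1 F)
    (hμ : ∀ᵐ p ∂μ, p ∈ cube0 ∪ cube1) : Integrable (fun p => turn p * (1 - p.2.1)) μ :=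
  hF.integrable_of_bound hμ (measurable_turn.mul (by fun_prop)) 1 fun p _ hy _ =>
    abs_le_one_of_mem (mul_mem_Icc_zero_one (turn_mem_Icc p)
      ⟨by linarith [hy.2], by linarith [hy.1]⟩)

theorem IsHorseshoeMap.integrable_central (hF : IsHorseshoeMap lam0 lam1 beta0 sig beta1 F)
    (hμ : ∀ᵐ p ∂μ, p ∈ cube0 ∪ cube1) : Integrable (fun p => p.2.1 * (1 - p.2.1)) μ :=
  hF.integrable_of_bound hμ (by fun_prop) 1 fun p _ hy _ =>
    abs_le_one_of_mem (mul_mem_Icc_zero_one hy ⟨by linarith [hy.2], by linarith [hy.1]⟩)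

theorem IsHorseshoeMap.integrable_log_rate (hF : IsHorseshoeMap lam0 lam1 beta0 sig beta1 F)
    (hμ : ∀ᵐ p ∂μ, p ∈ cube0 ∪ cube1) :
    Integrable (fun p => Real.log |centralRate sig p|) μ := by
  refine hF.integrable_of_bound hμ
    (Real.measurable_log.comp (continuous_abs.measurable.comp (measurable_centralRate sig)))
    (1 + |Real.log sig|) fun p _ hy _ => ?_
  unfold centralRate
  split_ifs
  · rw [log_rate_centralMap hy]
    have := log_denom_mem_Icc hy
    have h0 := abs_nonneg (Real.log sig)
    rw [abs_le]
    constructor <;> linarith [this.1, this.2]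
  · rw [Real.log_abs, Real.log_neg_eq_log]
    linarith

theorem IsHorseshoeMap.integral_log_rate (hF : IsHorseshoeMap lam0 lam1 beta0 sig beta1 F)
    {μ : ProbabilityMeasure (ℝ × ℝ × ℝ)}
    (hμ : ∀ᵐ p ∂(μ : Measure (ℝ × ℝ × ℝ)), p ∈ cube0 ∪ cube1) :
    centralExponent F μ = ∫ p, Real.log |centralRate sig p| ∂(μ : Measure (ℝ × ℝ × ℝ)) := by
  refine integral_congr_ae ?_
  filter_upwards [hμ] with p hp
  rw [hF.centralNorm_eq hp]

/-- The function `log (y (1 - y))` is a transfer function for the central derivative. -/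
theorem IsHorseshoeMap.log_rate_le_coboundary (hpar : Admissible lam0 lam1 beta0 sig beta1)
    (hF : IsHorseshoeMap lam0 lam1 beta0 sig beta1 F) {p : ℝ × ℝ × ℝ} (hp : p ∈ cube0 ∪ cube1)
    (hy : p.2.1 ∈ Ioo (0 : ℝ) 1) :
    Real.log |centralRate sig p| + (1 - sig) * (turn p * (1 - p.2.1)) ≤
      Real.log ((F p).2.1 * (1 - (F p).2.1)) - Real.log (p.2.1 * (1 - p.2.1)) := by
  obtain ⟨-, -, -, hb | hb⟩ := hF.cases hp
  · rw [hb.2, log_centralMap_mul hy, centralRate, if_pos hb.1, turn, if_pos hb.1,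
      log_rate_centralMap (Ioo_subset_Icc_self hy)]
    simp
  · rw [hb.2.2, centralRate, if_neg hb.1, turn, if_neg hb.1, Real.log_abs, Real.log_neg_eq_log,
      one_mul]
    exact log_turn_mul hpar.sig_pos (by linarith [hpar.sig_lt]) hy

theorem IsHorseshoeMap.integral_log_rate_le (hpar : Admissible lam0 lam1 beta0 sig beta1)
    (hF : IsHorseshoeMap lam0 lam1 beta0 sig beta1 F) (hT : MeasurePreserving F μ μ)
    (hμ : ∀ᵐ p ∂μ, p ∈ cube0 ∪ cube1) (hy : ∀ᵐ p ∂μ, p.2.1 ∈ Ioo (0 : ℝ) 1) :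
    ∫ p, Real.log |centralRate sig p| ∂μ + (1 - sig) * ∫ p, turn p * (1 - p.2.1) ∂μ ≤ 0 := by
  rw [← integral_const_mul, ← integral_add (hF.integrable_log_rate hμ)
    ((hF.integrable_turn_mul hμ).const_mul _)]
  refine integral_nonpos_of_le_coboundary
    (h := fun p => Real.log (p.2.1 * (1 - p.2.1))) hT (by fun_prop)
    ((hF.integrable_log_rate hμ).add ((hF.integrable_turn_mul hμ).const_mul _)) ?_
  filter_upwards [hμ, hy] with p hp hyp
  exact hF.log_rate_le_coboundary hpar hp hyp

/-- The transfer function is log(1 - y). It drops by at most 1 on R₀, and on R₁ it rises by at least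
-1 - log(1 - y), where -log(1 - y) ≥ M + 1 - e^M (1 - y). The free parameter M makes this usable:
after division by M, the mass of R₁ is at most 1/M plus a multiple of the integral of 1 - y over R₁.
-/
theorem IsHorseshoeMap.mul_integral_turn_le (hpar : Admissible lam0 lam1 beta0 sig beta1)
    (hF : IsHorseshoeMap lam0 lam1 beta0 sig beta1 F) (hT : MeasurePreserving F μ μ)
    (hμ : ∀ᵐ p ∂μ, p ∈ cube0 ∪ cube1) (hy : ∀ᵐ p ∂μ, p.2.1 ∈ Ioo (0 : ℝ) 1) (M : ℝ) :
    M * ∫ p, turn p ∂μ ≤ 1 + Real.exp M * ∫ p, turn p * (1 - p.2.1) ∂μ := by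
  have hi1 := (hF.integrable_turn hμ).const_mul M
  have hi2 := (hF.integrable_turn_mul hμ).const_mul (Real.exp M)
  have h := integral_nonpos_of_le_coboundary
    (k := fun p => M * turn p - Real.exp M * (turn p * (1 - p.2.1)) - 1)
    (h := fun p => Real.log (1 - p.2.1)) hT (by fun_prop)
    ((hi1.sub hi2).sub (integrable_const 1)) (by
      filter_upwards [hμ, hy] with p hp hyp
      have hyc := Ioo_subset_Icc_self hyp
      have h1 : 0 < 1 - p.2.1 := by linarith [hyp.2]
      obtain ⟨-, -, -, hb | hb⟩ := hF.cases hp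
      · rw [hb.2, turn, if_pos hb.1]
        simp only
        rw [one_sub_centralMap hyc, Real.log_div h1.ne' (centralFlow_denom_pos hyc 1).ne']
        linarith [(log_denom_mem_Icc hyc).2]
      · rw [hb.2.2, turn, if_neg hb.1]
        simp only
        have h2 : Real.exp (-1) ≤ 1 - sig * (1 - p.2.1) := by
          have h3 : Real.exp (-1) ≤ 1 / 2 := by
            rw [Real.exp_neg, ← one_div]
            exact one_div_le_one_div_of_le (by norm_num)
              (by linarith [Real.add_one_le_exp (1 : ℝ)])
          nlinarith [hpar.sig_pos, hpar.sig_lt, hyp.1]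
        have h4 := (Real.le_log_iff_exp_le (by nlinarith [Real.exp_pos (-1)])).2 h2
        have h5 := Real.log_le_sub_one_of_pos (mul_pos (Real.exp_pos M) h1)
        rw [Real.log_mul (Real.exp_pos M).ne' h1.ne', Real.log_exp] at h5
        linarith)
  have hi12 : Integrable (fun p => M * turn p - Real.exp M * (turn p * (1 - p.2.1))) μ :=
    hi1.sub hi2
  rw [integral_sub hi12 (integrable_const 1), integral_sub hi1 hi2, integral_const_mul,
    integral_const_mul] at h
  simp at h
  linarith

/-- This bound and the next two use the transfer functions -x, z and y. On R₀ each increases by at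
least a fixed multiple of the function to be bounded, and on R₁ the bounded loss is charged to
`turn`. -/
theorem IsHorseshoeMap.integral_fst_le (hpar : Admissible lam0 lam1 beta0 sig beta1)
    (hF : IsHorseshoeMap lam0 lam1 beta0 sig beta1 F) (hT : MeasurePreserving F μ μ)
    (hμ : ∀ᵐ p ∂μ, p ∈ cube0 ∪ cube1) : ∫ p, p.1 ∂μ ≤ 4 * ∫ p, turn p ∂μ := by
  have hi : Integrable (fun p : ℝ × ℝ × ℝ => p.1) μ :=
    hF.integrable_of_bound hμ (by fun_prop) 1 fun p hx _ _ => abs_le_one_of_mem hx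
  have ht := (hF.integrable_turn hμ).const_mul 2
  have h := integral_nonpos_of_le_coboundary (k := fun p => 1 / 2 * p.1 - 2 * turn p)
    (h := fun p => -p.1) hT (by fun_prop) ((hi.const_mul _).sub ht) (by
      filter_upwards [hμ] with p hp
      obtain ⟨hx, -, -, hb | hb⟩ := hF.cases hp
      · rw [hb.2, turn, if_pos hb.1]
        nlinarith [hpar.lam0_lt, hx.1]
      · rw [hb.2.2, turn, if_neg hb.1]
        nlinarith [hpar.lam1_pos, hx.1, hx.2])
  rw [integral_sub (hi.const_mul _) ht, integral_const_mul, integral_const_mul] at h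
  linarith

theorem IsHorseshoeMap.integral_snd_snd_le (hpar : Admissible lam0 lam1 beta0 sig beta1)
    (hF : IsHorseshoeMap lam0 lam1 beta0 sig beta1 F) (hT : MeasurePreserving F μ μ)
    (hμ : ∀ᵐ p ∂μ, p ∈ cube0 ∪ cube1) : ∫ p, p.2.2 ∂μ ≤ 2 * ∫ p, turn p ∂μ := by
  have hi : Integrable (fun p : ℝ × ℝ × ℝ => p.2.2) μ :=
    hF.integrable_of_bound hμ (by fun_prop) 1 fun p _ _ hz => abs_le_one_of_mem hz
  have ht := (hF.integrable_turn hμ).const_mul 2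
  have h := integral_nonpos_of_le_coboundary (k := fun p => p.2.2 - 2 * turn p)
    (h := fun p => p.2.2) hT (by fun_prop) (hi.sub ht) (by
      filter_upwards [hμ] with p hp
      obtain ⟨-, -, hz, hb | hb⟩ := hF.cases hp
      · rw [hb.2, turn, if_pos hb.1]
        nlinarith [hpar.lt_beta0, hz.1]
      · rw [hb.2.2, turn, if_neg hb.1]
        nlinarith [hpar.lt_beta1, hz.2, hb.2.1])
  rw [integral_sub hi ht, integral_const_mul] at h
  linarith

theorem IsHorseshoeMap.integral_central_le (hpar : Admissible lam0 lam1 beta0 sig beta1)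
    (hF : IsHorseshoeMap lam0 lam1 beta0 sig beta1 F) (hT : MeasurePreserving F μ μ)
    (hμ : ∀ᵐ p ∂μ, p ∈ cube0 ∪ cube1) :
    ∫ p, p.2.1 * (1 - p.2.1) ∂μ ≤ 4 * ∫ p, turn p ∂μ := by
  have hi := hF.integrable_central hμ
  have ht := (hF.integrable_turn hμ).const_mul 2
  have h := integral_nonpos_of_le_coboundary
    (k := fun p => 1 / 2 * (p.2.1 * (1 - p.2.1)) - 2 * turn p)
    (h := fun p => p.2.1) hT (by fun_prop) ((hi.const_mul _).sub ht) (by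
      filter_upwards [hμ] with p hp
      obtain ⟨-, hy, -, hb | hb⟩ := hF.cases hp
      · rw [hb.2, turn, if_pos hb.1]
        have := centralMap_sub_self_ge hy
        simp only
        linarith
      · rw [hb.2.2, turn, if_neg hb.1]
        have := mul_nonneg hpar.sig_pos.le (sub_nonneg.2 hy.2)
        nlinarith [hy.1, hy.2])
  rw [integral_sub (hi.const_mul _) ht, integral_const_mul, integral_const_mul] at h
  linarith

/-- On R₀ the integrand differs from 1 - 2y by at most 4y(1 - y), and on R₁ by at most 1 + |log σ|.
As the integral of y(1 - y) is at most four times the mass of R₁, the constant is 16 + 1 + |log σ|.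
-/
theorem IsHorseshoeMap.abs_integral_log_rate_sub_le
    (hpar : Admissible lam0 lam1 beta0 sig beta1)
    (hF : IsHorseshoeMap lam0 lam1 beta0 sig beta1 F) (hT : MeasurePreserving F μ μ)
    (hμ : ∀ᵐ p ∂μ, p ∈ cube0 ∪ cube1) :
    |∫ p, Real.log |centralRate sig p| ∂μ - (1 - 2 * ∫ p, p.2.1 ∂μ)| ≤
      (17 + |Real.log sig|) * ∫ p, turn p ∂μ := by
  have hi := (hF.integrable_central hμ).const_mul 4
  have ht := (hF.integrable_turn hμ).const_mul (1 + |Real.log sig|)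
  have hφ := hF.integrable_log_rate hμ
  have hy : Integrable (fun p : ℝ × ℝ × ℝ => 2 * p.2.1) μ :=
    hF.integrable_of_bound hμ (by fun_prop) 2 fun p _ hy _ => by
      rw [abs_of_nonneg (by linarith [hy.1])]; linarith [hy.2]
  have hy1 : Integrable (fun p : ℝ × ℝ × ℝ => 1 - 2 * p.2.1) μ := (integrable_const 1).sub hy
  have h1 : ∫ p, Real.log |centralRate sig p| ∂μ - (1 - 2 * ∫ p, p.2.1 ∂μ) =
      ∫ p, (Real.log |centralRate sig p| - (1 - 2 * p.2.1)) ∂μ := by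
    rw [integral_sub hφ hy1, integral_sub (integrable_const 1) hy,
      integral_const_mul]
    simp
  have h2 : ∫ p, |Real.log |centralRate sig p| - (1 - 2 * p.2.1)| ∂μ ≤
      ∫ p, (4 * (p.2.1 * (1 - p.2.1)) + (1 + |Real.log sig|) * turn p) ∂μ := by
    refine integral_mono_ae (hφ.sub hy1).abs (hi.add ht) ?_
    filter_upwards [hμ] with p hp
    obtain ⟨-, hy, -, hb | hb⟩ := hF.cases hp
    · rw [centralRate, if_pos hb.1, turn, if_pos hb.1, log_rate_centralMap hy]
      have := abs_le.1 (abs_log_denom_sub_le hy)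
      rw [abs_le]
      constructor <;> linarith [this.1, this.2]
    · rw [centralRate, if_neg hb.1, turn, if_neg hb.1, Real.log_abs, Real.log_neg_eq_log]
      have := mul_nonneg hy.1 (sub_nonneg.2 hy.2)
      rw [abs_le]
      constructor <;>
        linarith [hy.1, hy.2, neg_abs_le (Real.log sig), le_abs_self (Real.log sig)]
  rw [integral_add hi ht, integral_const_mul, integral_const_mul] at h2
  rw [h1]
  refine (abs_integral_le_integral_abs).trans (h2.trans ?_)
  linarith [hF.integral_central_le hpar hT hμ]

end Invariant

end CentralHorseshoe

namespace CentralHorseshoe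

/-! ### Recurrent points -/

section Orbits

variable {lam0 lam1 beta0 sig beta1 : ℝ} {F : ℝ × ℝ × ℝ → ℝ × ℝ × ℝ}

/-- Values in `EReal` keep the lower limit meaningful when the averages are not known to be bounded
below. -/
theorem liminf_div_le_zero {S : ℕ → ℝ} {C : ℝ} (h : ∀ᶠ n in atTop, S n ≤ C) :
    liminf (fun n : ℕ => ((1 / (n : ℝ) * S n : ℝ) : EReal)) atTop ≤ 0 := by
  have h1 : Tendsto (fun n : ℕ => ((1 / (n : ℝ) * C : ℝ) : EReal)) atTop (𝓝 0) := by
    have := tendsto_one_div_atTop_nhds_zero_nat.mul_const C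
    rw [zero_mul] at this
    exact (continuous_coe_real_ereal.tendsto 0).comp this
  rw [← h1.liminf_eq]
  refine liminf_le_liminf ?_
  filter_upwards [h] with n hn
  exact EReal.coe_le_coe_iff.2 (mul_le_mul_of_nonneg_left hn (by positivity))

/-- A forward orbit which stays in `R₀` and in the plane `y = 0` converges to `Q`. -/
theorem IsHorseshoeMap.tendsto_Q (hpar : Admissible lam0 lam1 beta0 sig beta1)
    (hF : IsHorseshoeMap lam0 lam1 beta0 sig beta1 F) {p : ℝ × ℝ × ℝ}
    (hp : ∀ n : ℕ, F^[n] p ∈ cube0 ∪ cube1) (h0 : ∀ n : ℕ, (F^[n] p).2.1 = 0) :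
    Tendsto (fun n : ℕ => F^[n] p) atTop (𝓝 Q) := by
  have hb : ∀ n : ℕ, F^[n + 1] p =
      (lam0 * (F^[n] p).1, centralMap (F^[n] p).2.1, beta0 * (F^[n] p).2.2) := by
    intro n
    rw [Function.iterate_succ_apply']
    obtain ⟨-, -, -, hb | hb⟩ := hF.cases (hp n)
    · exact hb.2
    · have h1 := h0 (n + 1)
      rw [Function.iterate_succ_apply', hb.2.2, h0 n] at h1
      have := hpar.sig_pos
      norm_num at h1
      exact absurd h1 this.ne'
  have hx : ∀ n : ℕ, (F^[n] p).1 = lam0 ^ n * p.1 := by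
    intro n
    induction n with
    | zero => simp
    | succ n ih => rw [hb, ih]; ring
  have hz : ∀ n : ℕ, (F^[n] p).2.2 = beta0 ^ n * p.2.2 := by
    intro n
    induction n with
    | zero => simp
    | succ n ih => rw [hb, ih]; ring
  have hz0 : p.2.2 = 0 := by
    by_contra hne
    have hpos : 0 < p.2.2 := lt_of_le_of_ne (hF.cases (hp 0)).2.2.1.1 (Ne.symm hne)
    obtain ⟨n, hn⟩ := pow_unbounded_of_one_lt (1 / p.2.2)
      (by linarith [hpar.lt_beta0] : (1 : ℝ) < beta0)
    rw [div_lt_iff₀ hpos, ← hz n] at hn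
    exact not_le.2 hn (hF.cases (hp n)).2.2.1.2
  have heq : (fun n : ℕ => F^[n] p) = fun n => (lam0 ^ n * p.1, 0, 0) := by
    funext n
    ext
    · exact hx n
    · exact h0 n
    · rw [hz, hz0, mul_zero]
  rw [heq]
  have := (tendsto_pow_atTop_nhds_zero_of_lt_one hpar.lam0_pos.le
    (by linarith [hpar.lam0_lt] : lam0 < 1)).mul_const p.1
  rw [zero_mul] at this
  exact this.prodMk_nhds tendsto_const_nhds

theorem log_mul_one_sub_nonpos {y : ℝ} (hy : y ∈ Icc (0 : ℝ) 1) : Real.log (y * (1 - y)) ≤ 0 :=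
  have h := mul_mem_Icc_zero_one hy ⟨by linarith [hy.2], by linarith [hy.1]⟩
  Real.log_nonpos h.1 h.2

theorem IsHorseshoeMap.liminf_le_zero (hpar : Admissible lam0 lam1 beta0 sig beta1)
    (hF : IsHorseshoeMap lam0 lam1 beta0 sig beta1 F) {p : ℝ × ℝ × ℝ} (hp : IsRecurrentPt F p)
    (hpQ : p ≠ Q) :
    liminf (fun n : ℕ => ((1 / (n : ℝ) * Real.log (centralNorm (F^[n]) p) : ℝ) : EReal))
      atTop ≤ 0 := by
  have hmem := hF.iterate_mem hp.1
  have hlog := hF.log_centralNorm_iterate hpar.sig_pos hmem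
  by_cases hIoo : ∃ m : ℕ, (F^[m] p).2.1 ∈ Ioo (0 : ℝ) 1
  · obtain ⟨m, hm⟩ := hIoo
    have hall : ∀ n, m ≤ n → (F^[n] p).2.1 ∈ Ioo (0 : ℝ) 1 := by
      intro n hn
      induction n, hn using Nat.le_induction with
      | base => exact hm
      | succ n _ ih =>
        rw [Function.iterate_succ_apply']
        exact hF.snd_mem_Ioo hpar (hmem n) ih
    let h : ℕ → ℝ := fun n => Real.log ((F^[n] p).2.1 * (1 - (F^[n] p).2.1))
    -- The coboundary inequality telescopes from time m on; the defect terms are nonnegative and are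
    -- dropped.
    have hS : ∀ n, m ≤ n → Real.log (centralNorm (F^[n]) p) ≤
        Real.log (centralNorm (F^[m]) p) + (h n - h m) := by
      intro n hn
      induction n, hn using Nat.le_induction with
      | base => simp
      | succ n hn ih =>
        have h1 := hF.log_rate_le_coboundary hpar (hmem n) (hall n hn)
        rw [← Function.iterate_succ_apply' F n p] at h1
        have h2 : 0 ≤ (1 - sig) * (turn (F^[n] p) * (1 - (F^[n] p).2.1)) :=
          mul_nonneg (by linarith [hpar.sig_lt])
            (mul_nonneg (turn_mem_Icc _).1 (by linarith [(hall n hn).2]))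
        have h3 : Real.log (centralNorm (F^[n + 1]) p) = Real.log (centralNorm (F^[n]) p) +
            Real.log |centralRate sig (F^[n] p)| := by
          rw [hlog, hlog, Finset.sum_range_succ]
        rw [h3]
        simp only [h] at ih ⊢
        linarith
    refine liminf_div_le_zero (C := Real.log (centralNorm (F^[m]) p) - h m) ?_
    filter_upwards [eventually_ge_atTop m] with n hn
    have h4 : h n ≤ 0 := log_mul_one_sub_nonpos (Ioo_subset_Icc_self (hall n hn))
    linarith [hS n hn]
  push Not at hIoo
  have h01 : ∀ n : ℕ, (F^[n] p).2.1 = 0 ∨ (F^[n] p).2.1 = 1 := by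
    intro n
    by_contra! hc
    have hy := (hF.cases (hmem n)).2.1
    exact hIoo n ⟨lt_of_le_of_ne hy.1 (Ne.symm hc.1), lt_of_le_of_ne hy.2 hc.2⟩
  -- An orbit that reaches y = 0 and never enters 0 < y < 1 stays at y = 0 and converges to Q, so
  -- recurrence would force p = Q. Otherwise y = 1 throughout, and each step contributes -1.
  by_cases hzero : ∃ m : ℕ, (F^[m] p).2.1 = 0
  · obtain ⟨m, hm⟩ := hzero
    exfalso
    have hall : ∀ n, (F^[n] (F^[m] p)).2.1 = 0 := by
      intro n
      induction n with
      | zero => exact hm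
      | succ n ih =>
        rw [← Function.iterate_add_apply] at ih
        rw [← Function.iterate_add_apply, Nat.succ_add]
        refine (h01 _).resolve_right fun h1 => ?_
        have := hF.snd_lt_one hpar (hmem (n + m)) (by rw [ih]; norm_num)
        rw [← Function.iterate_succ_apply' F] at this
        exact this.ne h1
    have hT := hF.tendsto_Q hpar (p := F^[m] p)
      (fun n => by rw [← Function.iterate_add_apply]; exact hmem _) hall
    simp only [← Function.iterate_add_apply] at hT
    rw [tendsto_add_atTop_iff_nat (f := fun n : ℕ => F^[n] p)] at hT
    have hc : ClusterPt p (𝓝 Q) := ClusterPt.mono hp.2 hT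
    exact hpQ (eq_of_nhds_neBot hc)
  push Not at hzero
  have hone : ∀ n : ℕ, (F^[n] p).2.1 = 1 := fun n => (h01 n).resolve_left (hzero n)
  refine liminf_div_le_zero (C := 0) (Eventually.of_forall fun n => ?_)
  rw [hlog]
  refine Finset.sum_nonpos fun i _ => ?_
  obtain ⟨-, hy, -, hb | hb⟩ := hF.cases (hmem i)
  · rw [centralRate, if_pos hb.1, log_rate_centralMap hy, hone i]
    norm_num
  · have := hone (i + 1)
    rw [Function.iterate_succ_apply', hb.2.2, hone i] at this
    norm_num at this

end Orbits

/-! ### Central exponents and the weak* limit -/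

section Measures

variable {lam0 lam1 beta0 sig beta1 : ℝ} {F : ℝ × ℝ × ℝ → ℝ × ℝ × ℝ}

theorem IsErgodicMeasure.ae_mem (hF : IsHorseshoeMap lam0 lam1 beta0 sig beta1 F)
    {μ : ProbabilityMeasure (ℝ × ℝ × ℝ)} (hμ : IsErgodicMeasure F μ) :
    ∀ᵐ p ∂(μ : Measure (ℝ × ℝ × ℝ)), p ∈ cube0 ∪ cube1 := by
  filter_upwards [hμ.1] with p hp
  exact hF.iterate_mem hp 0

theorem IsHorseshoeMap.centralExponent_dirac_Q
    (hF : IsHorseshoeMap lam0 lam1 beta0 sig beta1 F) {μ : ProbabilityMeasure (ℝ × ℝ × ℝ)}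
    (hμ : (μ : Measure (ℝ × ℝ × ℝ)) = Measure.dirac Q) : centralExponent F μ = 1 := by
  have hQ : Q ∈ cube0 ∪ cube1 := by
    left; simp [Q, cube0]
  rw [centralExponent, hμ, integral_dirac, hF.centralNorm_eq hQ]
  simp [centralRate, Q]

theorem IsHorseshoeMap.centralExponent_dirac_P
    (hF : IsHorseshoeMap lam0 lam1 beta0 sig beta1 F) {μ : ProbabilityMeasure (ℝ × ℝ × ℝ)}
    (hμ : (μ : Measure (ℝ × ℝ × ℝ)) = Measure.dirac P) : centralExponent F μ = -1 := by
  have hP : P ∈ cube0 ∪ cube1 := by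
    left; simp [P, cube0]
  have h1 : P.2.2 ≤ 1 / 6 := by norm_num [P]
  rw [centralExponent, hμ, integral_dirac, hF.centralNorm_eq hP, centralRate, if_pos h1,
    log_rate_centralMap (hF.cases hP).2.1]
  norm_num [P]

theorem integral_turn_nonneg (μ : Measure (ℝ × ℝ × ℝ)) : 0 ≤ ∫ p, turn p ∂μ :=
  integral_nonneg fun p => (turn_mem_Icc p).1

theorem IsHorseshoeMap.centralExponent_neg (hpar : Admissible lam0 lam1 beta0 sig beta1)
    (hF : IsHorseshoeMap lam0 lam1 beta0 sig beta1 F) {μ : ProbabilityMeasure (ℝ × ℝ × ℝ)}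
    (hμ : IsErgodicMeasure F μ) (hQ : (μ : Measure (ℝ × ℝ × ℝ)) ≠ Measure.dirac Q) :
    centralExponent F μ < 0 := by
  have hmem := hμ.ae_mem hF
  have hT := hμ.2.toMeasurePreserving
  rcases hF.ergodic_trichotomy hpar hμ.2 hmem with h | h | hy
  · exact absurd h hQ
  · rw [hF.centralExponent_dirac_P h]
    norm_num
  rw [hF.integral_log_rate hmem]
  by_contra! hneg
  have h1 := hF.integral_log_rate_le hpar hT hmem hy
  have hs : 0 < 1 - sig := by linarith [hpar.sig_lt]
  set t := ∫ p, turn p * (1 - p.2.1) ∂(μ : Measure (ℝ × ℝ × ℝ)) with ht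
  have ht0 : t ≤ 0 := nonpos_of_mul_nonpos_right (by linarith) hs
  have hm0 : ∫ p, turn p ∂(μ : Measure (ℝ × ℝ × ℝ)) ≤ 0 := by
    by_contra! hpos
    -- With M equal to 2 over the mass of R₁, the left side is 2 while the right side is at most 1.
    have h2 := hF.mul_integral_turn_le hpar hT hmem hy
      (2 / ∫ p, turn p ∂(μ : Measure (ℝ × ℝ × ℝ)))
    rw [div_mul_cancel₀ _ hpos.ne', ← ht] at h2
    have := mul_nonpos_of_nonneg_of_nonpos
      (Real.exp_pos (2 / ∫ p, turn p ∂(μ : Measure (ℝ × ℝ × ℝ)))).le ht0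
    linarith
  have hc := hF.integral_central_le hpar hT hmem
  have hpos : ∀ᵐ p ∂(μ : Measure (ℝ × ℝ × ℝ)), 0 < p.2.1 * (1 - p.2.1) := by
    filter_upwards [hy] with p hp
    exact mul_pos hp.1 (sub_pos.2 hp.2)
  have hnn := hpos.mono fun p hp => hp.le
  have hz := (integral_eq_zero_iff_of_nonneg_ae hnn (hF.integrable_central hmem)).1
    (le_antisymm (by linarith) (integral_nonneg_of_ae hnn))
  obtain ⟨p, hp1, hp2⟩ := (hpos.and hz).exists
  exact hp1.ne' hp2

/-- A continuous function is close to the interpolation of its values at `Q` and `P`, up to a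
multiple of a function which vanishes exactly at these points of the cube. -/
theorem exists_abs_sub_interpolation_le (ψ : BoundedContinuousFunction (ℝ × ℝ × ℝ) ℝ) {ε : ℝ}
    (hε : 0 < ε) : ∃ C : ℝ, 0 ≤ C ∧ ∀ p ∈ cube,
      |ψ p - (ψ Q + (ψ P - ψ Q) * p.2.1)| ≤ ε + C * (p.1 + p.2.2 + p.2.1 * (1 - p.2.1)) := by
  let g : ℝ × ℝ × ℝ → ℝ := fun p => |ψ p - (ψ Q + (ψ P - ψ Q) * p.2.1)|
  let w : ℝ × ℝ × ℝ → ℝ := fun p => p.1 + p.2.2 + p.2.1 * (1 - p.2.1)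
  have hg : Continuous g := by fun_prop
  have hw : Continuous w := by fun_prop
  have hcube : IsCompact cube := isCompact_Icc.prod (isCompact_Icc.prod isCompact_Icc)
  have hw0 : ∀ p ∈ cube, 0 ≤ w p := fun p ⟨hx, hy, hz⟩ =>
    add_nonneg (add_nonneg hx.1 hz.1) (mul_nonneg hy.1 (sub_nonneg.2 hy.2))
  -- On this compact set the weight w has no zeros, since g vanishes at Q and P; so g / w is bounded
  -- there, and the bound serves as C.
  have hK : IsCompact (cube ∩ {p | ε ≤ g p}) :=
    hcube.inter_right (isClosed_le continuous_const hg)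
  have hpos : ∀ p ∈ cube ∩ {p | ε ≤ g p}, w p ≠ 0 := by
    rintro p ⟨⟨hx, hy, hz⟩, hgp⟩ hwp
    have h1 := mul_nonneg hy.1 (sub_nonneg.2 hy.2)
    have h2 : p.1 = 0 := by
      simp only [w] at hwp
      linarith [hx.1, hz.1]
    have h3 : p.2.2 = 0 := by
      simp only [w] at hwp
      linarith [hx.1, hz.1]
    have h4 : p.2.1 * (1 - p.2.1) = 0 := by
      simp only [w] at hwp
      linarith
    have h5 : g p = 0 := by
      rcases mul_eq_zero.1 h4 with h | h
      · have : p = Q := by ext <;> assumption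
        simp [g, this, Q]
      · have : p = P := by
          ext
          · exact h2
          · exact (sub_eq_zero.1 h).symm
          · exact h3
        simp [g, this, P]
    have : ε ≤ g p := hgp
    linarith
  obtain ⟨C, hC⟩ := hK.exists_bound_of_continuousOn (f := fun p => g p / w p)
    (hg.continuousOn.div hw.continuousOn hpos)
  refine ⟨max C 0, le_max_right _ _, fun p hp => ?_⟩
  have hm : 0 ≤ max C 0 * w p := mul_nonneg (le_max_right _ _) (hw0 p hp)
  by_cases hgp : ε ≤ g p
  · have h1 := (le_abs_self _).trans ((hC p ⟨hp, hgp⟩).trans (le_max_left C 0))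
    rw [div_le_iff₀ (lt_of_le_of_ne (hw0 p hp) (hpos p ⟨hp, hgp⟩).symm)] at h1
    show g p ≤ ε + max C 0 * w p
    linarith
  · show g p ≤ ε + max C 0 * w p
    linarith

theorem integral_halfDirac (ψ : ℝ × ℝ × ℝ → ℝ) :
    ∫ p, ψ p ∂(halfDirac : Measure (ℝ × ℝ × ℝ)) = (ψ Q + ψ P) / 2 := by
  have h : (halfDirac : Measure (ℝ × ℝ × ℝ)) =
      (2 : ENNReal)⁻¹ • (Measure.dirac Q + Measure.dirac P) := rfl
  rw [h, integral_smul_measure, integral_add_measure (integrable_dirac (by simp))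
    (integrable_dirac (by simp)), integral_dirac, integral_dirac]
  simp
  ring

/-- The constant 10 is 4 + 2 + 4, from the bounds for the integrals of x, z and y(1 - y). -/
theorem IsHorseshoeMap.abs_integral_sub_le (hpar : Admissible lam0 lam1 beta0 sig beta1)
    (hF : IsHorseshoeMap lam0 lam1 beta0 sig beta1 F) {μ : Measure (ℝ × ℝ × ℝ)}
    [IsProbabilityMeasure μ] (hT : MeasurePreserving F μ μ)
    (hμ : ∀ᵐ p ∂μ, p ∈ cube0 ∪ cube1) (ψ : BoundedContinuousFunction (ℝ × ℝ × ℝ) ℝ)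
    {ε C : ℝ} (hC0 : 0 ≤ C) (hC : ∀ p ∈ cube,
      |ψ p - (ψ Q + (ψ P - ψ Q) * p.2.1)| ≤ ε + C * (p.1 + p.2.2 + p.2.1 * (1 - p.2.1))) :
    |∫ p, ψ p ∂μ - (ψ Q + (ψ P - ψ Q) * ∫ p, p.2.1 ∂μ)| ≤ ε + C * (10 * ∫ p, turn p ∂μ) := by
  have hψ : Integrable ψ μ := ψ.integrable μ
  have hx : Integrable (fun p : ℝ × ℝ × ℝ => p.1) μ :=
    hF.integrable_of_bound hμ (by fun_prop) 1 fun p hx _ _ => abs_le_one_of_mem hx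
  have hy : Integrable (fun p : ℝ × ℝ × ℝ => p.2.1) μ :=
    hF.integrable_of_bound hμ (by fun_prop) 1 fun p _ hy _ => abs_le_one_of_mem hy
  have hz : Integrable (fun p : ℝ × ℝ × ℝ => p.2.2) μ :=
    hF.integrable_of_bound hμ (by fun_prop) 1 fun p _ _ hz => abs_le_one_of_mem hz
  have hv := hF.integrable_central hμ
  have hxz : Integrable (fun p : ℝ × ℝ × ℝ => p.1 + p.2.2) μ := hx.add hz
  have hw : Integrable (fun p : ℝ × ℝ × ℝ => C * (p.1 + p.2.2 + p.2.1 * (1 - p.2.1))) μ :=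
    (hxz.add hv).const_mul C
  have hl : Integrable (fun p : ℝ × ℝ × ℝ => ψ Q + (ψ P - ψ Q) * p.2.1) μ :=
    (integrable_const _).add (hy.const_mul _)
  have h1 : ∫ p, ψ p ∂μ - (ψ Q + (ψ P - ψ Q) * ∫ p, p.2.1 ∂μ) =
      ∫ p, (ψ p - (ψ Q + (ψ P - ψ Q) * p.2.1)) ∂μ := by
    rw [integral_sub hψ hl, integral_add (integrable_const _) (hy.const_mul _),
      integral_const_mul]
    simp
  have h2 : ∫ p, |ψ p - (ψ Q + (ψ P - ψ Q) * p.2.1)| ∂μ ≤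
      ∫ p, (ε + C * (p.1 + p.2.2 + p.2.1 * (1 - p.2.1))) ∂μ := by
    refine integral_mono_ae (hψ.sub hl).abs ((integrable_const ε).add hw) ?_
    filter_upwards [hμ] with p hp
    obtain ⟨hx, hy, hz, -⟩ := hF.cases hp
    exact hC p ⟨hx, hy, hz⟩
  rw [integral_add (integrable_const ε) hw, integral_const_mul, integral_add hxz hv,
    integral_add hx hz] at h2
  rw [h1]
  refine abs_integral_le_integral_abs.trans (h2.trans ?_)
  simp only [integral_const, probReal_univ, one_smul]
  refine add_le_add_right (mul_le_mul_of_nonneg_left ?_ hC0) ε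
  linarith [hF.integral_fst_le hpar hT hμ, hF.integral_snd_snd_le hpar hT hμ,
    hF.integral_central_le hpar hT hμ]

theorem IsHorseshoeMap.tendsto_halfDirac (hpar : Admissible lam0 lam1 beta0 sig beta1)
    (hF : IsHorseshoeMap lam0 lam1 beta0 sig beta1 F) {μ : ℕ → ProbabilityMeasure (ℝ × ℝ × ℝ)}
    (hμ : ∀ n, IsErgodicMeasure F (μ n))
    (hlim : Tendsto (fun n => centralExponent F (μ n)) atTop (𝓝 0)) :
    Tendsto μ atTop (𝓝 halfDirac) := by
  have hs : 0 < 1 - sig := by linarith [hpar.sig_lt]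
  have hmem := fun n => (hμ n).ae_mem hF
  have hT := fun n => (hμ n).2.toMeasurePreserving
  -- The exponents of δ_Q and δ_P are 1 and -1, so neither occurs once |λ| < 1.
  have hIoo : ∀ᶠ n in atTop, ∀ᵐ p ∂(μ n : Measure (ℝ × ℝ × ℝ)), p.2.1 ∈ Ioo (0 : ℝ) 1 := by
    filter_upwards [hlim.eventually (Ioo_mem_nhds (by norm_num : (-1 : ℝ) < 0) one_pos)]
      with n hn
    rcases hF.ergodic_trichotomy hpar (hμ n).2 (hmem n) with h | h | h
    · exact absurd (hF.centralExponent_dirac_Q h) hn.2.ne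
    · exact absurd (hF.centralExponent_dirac_P h) hn.1.ne'
    · exact h
  have hturn : Tendsto (fun n => ∫ p, turn p ∂(μ n : Measure (ℝ × ℝ × ℝ))) atTop (𝓝 0) := by
    rw [Metric.tendsto_atTop']
    intro ε hε
    -- With this M, it suffices that the term with e^M be less than 1: then M times the mass of R₁
    -- is less than 2 = Mε.
    let M := 2 / ε
    have hMpos : 0 < M := by positivity
    have hl2 : Tendsto (fun n => Real.exp M * (-centralExponent F (μ n) / (1 - sig))) atTop
        (𝓝 0) := by
      simpa using (hlim.neg.div_const (1 - sig)).const_mul (Real.exp M)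
    have hev : ∀ᶠ n in atTop, dist (∫ p, turn p ∂(μ n : Measure (ℝ × ℝ × ℝ))) 0 < ε := by
      filter_upwards [hIoo, hl2.eventually (gt_mem_nhds one_pos)] with n hn1 hn2
      have h1 := hF.integral_log_rate_le hpar (hT n) (hmem n) hn1
      rw [← hF.integral_log_rate (hmem n)] at h1
      have h2 := hF.mul_integral_turn_le hpar (hT n) (hmem n) hn1 M
      have h3 : ∫ p, turn p * (1 - p.2.1) ∂(μ n : Measure (ℝ × ℝ × ℝ)) ≤
          -centralExponent F (μ n) / (1 - sig) := by
        rw [le_div_iff₀ hs]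
        linarith
      have h4 := mul_le_mul_of_nonneg_left h3 (Real.exp_pos M).le
      rw [dist_zero_right, Real.norm_eq_abs, abs_of_nonneg (integral_turn_nonneg _)]
      have h5 : M * ∫ p, turn p ∂(μ n : Measure (ℝ × ℝ × ℝ)) < M * ε := by
        rw [show M * ε = 2 from div_mul_cancel₀ 2 hε.ne']
        linarith
      exact lt_of_mul_lt_mul_left h5 hMpos.le
    obtain ⟨N, hN⟩ := eventually_atTop.1 hev
    exact ⟨N, fun n hn => hN n hn.le⟩
  have hy : Tendsto (fun n => ∫ p, p.2.1 ∂(μ n : Measure (ℝ × ℝ × ℝ))) atTop (𝓝 (1 / 2)) := by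
    have h1 : Tendsto (fun n => centralExponent F (μ n) -
        (1 - 2 * ∫ p, p.2.1 ∂(μ n : Measure (ℝ × ℝ × ℝ)))) atTop (𝓝 0) := by
      refine squeeze_zero_norm (fun n => ?_)
        (by simpa using hturn.const_mul (17 + |Real.log sig|))
      rw [Real.norm_eq_abs, hF.integral_log_rate (hmem n)]
      exact hF.abs_integral_log_rate_sub_le hpar (hT n) (hmem n)
    -- Solves λ - (1 - 2∫y) → 0 and λ → 0 for ∫y.
    have h2 := ((h1.sub hlim).add_const 1).div_const 2
    have h3 : (0 - 0 + 1 : ℝ) / 2 = 1 / 2 := by norm_num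
    rw [h3] at h2
    refine h2.congr fun n => ?_
    ring
  rw [ProbabilityMeasure.tendsto_iff_forall_integral_tendsto]
  intro ψ
  rw [integral_halfDirac]
  have hI : Tendsto (fun n => ψ Q + (ψ P - ψ Q) * ∫ p, p.2.1 ∂(μ n : Measure (ℝ × ℝ × ℝ)))
      atTop (𝓝 ((ψ Q + ψ P) / 2)) := by
    have := (hy.const_mul (ψ P - ψ Q)).const_add (ψ Q)
    rwa [show ψ Q + (ψ P - ψ Q) * (1 / 2) = (ψ Q + ψ P) / 2 by ring] at this
  have hd : Tendsto (fun n => ∫ p, ψ p ∂(μ n : Measure (ℝ × ℝ × ℝ)) -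
      (ψ Q + (ψ P - ψ Q) * ∫ p, p.2.1 ∂(μ n : Measure (ℝ × ℝ × ℝ)))) atTop (𝓝 0) := by
    rw [Metric.tendsto_nhds]
    intro ε hε
    obtain ⟨C, hC0, hC⟩ := exists_abs_sub_interpolation_le ψ (half_pos hε)
    have hl : Tendsto (fun n => C * (10 * ∫ p, turn p ∂(μ n : Measure (ℝ × ℝ × ℝ)))) atTop
        (𝓝 0) := by
      simpa using (hturn.const_mul 10).const_mul C
    filter_upwards [hl.eventually (gt_mem_nhds (half_pos hε))] with n hn
    rw [dist_zero_right, Real.norm_eq_abs]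
    have := hF.abs_integral_sub_le hpar (hT n) (hmem n) ψ hC0 hC
    linarith
  simpa using hd.add hI

end Measures

end CentralHorseshoe

theorem theoremt (lam0 lam1 beta0 sig beta1 : ℝ)
    (hpar : CentralHorseshoe.Admissible lam0 lam1 beta0 sig beta1)
    (F : ℝ × ℝ × ℝ → ℝ × ℝ × ℝ)
    (hF : CentralHorseshoe.IsHorseshoeMap lam0 lam1 beta0 sig beta1 F) :
    ((∀ p : ℝ × ℝ × ℝ, CentralHorseshoe.IsRecurrentPt F p → p ≠ CentralHorseshoe.Q →
        liminf (fun n : ℕ =>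
          ((1 / (n : ℝ) * Real.log (CentralHorseshoe.centralNorm (F^[n]) p) : ℝ) : EReal))
          atTop ≤ 0) ∧
      (∀ μ : ProbabilityMeasure (ℝ × ℝ × ℝ), CentralHorseshoe.IsErgodicMeasure F μ →
        (μ : Measure (ℝ × ℝ × ℝ)) ≠ Measure.dirac CentralHorseshoe.Q →
        CentralHorseshoe.centralExponent F μ < 0)) ∧
    (∀ μ : ℕ → ProbabilityMeasure (ℝ × ℝ × ℝ),
      (∀ n, CentralHorseshoe.IsErgodicMeasure F (μ n)) →
      Tendsto (fun n => CentralHorseshoe.centralExponent F (μ n)) atTop (𝓝 0) →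
      Tendsto μ atTop (𝓝 CentralHorseshoe.halfDirac)) :=
  ⟨⟨fun _ hp hpQ => hF.liminf_le_zero hpar hp hpQ,
    fun _ hμ hQ => hF.centralExponent_neg hpar hμ hQ⟩,
    fun _ hμ hlim => hF.tendsto_halfDirac hpar hμ hlim⟩
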